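/- Let $K$ be a field and let $A$ be a finite-dimensional associative unital $K$-algebra which is basic pointed, i.e. $A/J(A)\cong K^n$ as $K$-algebras for some $n\ge 0$, where $J(A)$ is the Jacobson radical (equivalently, $A/J(A)$ is a product of division rings and $\operatorname{End}_A(S)=K$ for every simple $A$-module $S$). Representations of $A$ are left $A$-modules. A representation $M$ is *faithful* if no nonzero element of $A$ annihilates $M$, and *distributive* if $X\cap(Y+Z)=(X\cap Y)+(X\cap Z)$ for all submodules $X,Y,Z$ of $M$. For a finite-dimensional representation $M$ and a simple module $S$, let $[M:S]$ be the number of factors isomorphic to $S$ in a composition series of $M$; $M$ is *thin* if $[M:S]\le 1$ for every simple $S$, and a *1-representation* if $[M:S]=1$ for every simple $S$. The algebra $A$ is *acyclic* if its Ext quiver (vertices: isomorphism classes of simple $A$-modules, with an arrow from $S$ to $T$ exactly when $\operatorname{Ext}^1_A(S,T)\ne 0$) has no oriented cycle, loops included. For a finite poset $P$, the incidence algebra $I(P,K)$ is the algebra of functions $f:P\times P\to K$ with $f(x,y)=0$ whenever $x\not\le y$, with pointwise addition and scalar multiplication and with product $(fg)(x,y)=\sum_{x\le z\le y}f(x,z)g(z,y)$.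 Then the following are equivalent: 1. $A\cong I(P,K)$ as $K$-algebras for some finite poset $P$. 2. $A$ is acyclic and has a faithful distributive representation (equivalently, $A$ is acyclic and has a faithful finite-dimensional distributive representation). 3. $A$ has a faithful finite-dimensional thin representation; equivalently, $A$ has a faithful finite-dimensional 1-representation. -/

import Mathlib

universe u v w

/-- A finite-dimensional `K`-algebra `A` is *basic pointed* if `A / J(A)` is isomorphic, as a
`K`-algebra, to a finite product of copies of `K`. Equivalently: `A` is basic (`A / J(A)` is a
product of division rings) and `End_A(S) = K` for every simple module `S`. -/
def IsBasicPointed (K : Type u) (A : Type v) [Field K] [Ring A] [Algebra K A] : Prop :=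
  ∃ n : ℕ, Nonempty ((A ⧸ Ring.jacobson A) ≃ₐ[K] (Fin n → K))

/-- `A` is (isomorphic to) the incidence algebra over `K` of a finite poset `P`. The instances of
`LocallyFiniteOrder` and `DecidableEq` are unique and always exist on a finite poset; they are only
needed to write down the multiplication and the unit. -/
def IsPosetIncidenceAlgebra (K : Type u) (A : Type v) [Field K] [Ring A] [Algebra K A] : Prop :=
  ∃ (P : Type) (_ : PartialOrder P) (_ : Finite P) (_ : LocallyFiniteOrder P) (_ : DecidableEq P),
    Nonempty (A ≃ₐ[K] IncidenceAlgebra K P)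

/-- The simple left `A`-modules, as objects of the category of `A`-modules: the vertices of the
`Ext` quiver of `A` (before passing to isomorphism classes). -/
def SimpleModules (A : Type v) [Ring A] : Type (v + 1) :=
  {S : ModuleCat.{v} A // IsSimpleModule A S}

/-- There is at least one arrow from `S` to `T` in the `Ext` quiver: `Ext¹_A(S, T) ≠ 0`. -/
def ExtArrow (A : Type v) [Ring A] (S T : SimpleModules A) : Prop :=
  Nontrivial (CategoryTheory.Abelian.Ext.{v} S.1 T.1 1)

/-- `A` is *acyclic*: its `Ext` quiver has no oriented cycle (loops included). As `Ext¹` is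
invariant under isomorphism, a cycle through isomorphism classes of simple modules can be
represented by a cycle of simple modules that returns to the very module it started from. -/
def IsAcyclicAlgebra (A : Type v) [Ring A] : Prop :=
  ∀ S : SimpleModules A, ¬ Relation.TransGen (ExtArrow A) S S

/-- A module is *distributive* if its lattice of submodules is distributive. -/
def IsDistributiveModule (A : Type v) (M : Type w) [Ring A] [AddCommGroup M] [Module A M] : Prop :=
  ∀ X Y Z : Submodule A M, X ⊓ (Y ⊔ Z) = (X ⊓ Y) ⊔ (X ⊓ Z)

/-- The number of factors of the composition series `s` that are isomorphic to `S`. -/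
noncomputable def factorCount {A : Type v} {M : Type w} [Ring A] [AddCommGroup M] [Module A M]
    (s : CompositionSeries (Submodule A M)) (S : Type u) [AddCommGroup S] [Module A S] : ℕ :=
  Nat.card {i : Fin s.length //
    Nonempty ((s i.succ ⧸ (s i.castSucc).submoduleOf (s i.succ)) ≃ₗ[A] S)}

/-- The Jordan–Hölder multiplicity `[M : S]`: the number of factors isomorphic to `S` in a
composition series of `M` (it is independent of the series, and we put it to be `0` if `M` has no
composition series, a case that does not occur for finite-dimensional modules). -/
noncomputable def jhMultiplicity (A : Type v) (M : Type w) [Ring A] [AddCommGroup M] [Module A M]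
    (S : Type u) [AddCommGroup S] [Module A S] : ℕ :=
  open Classical in
  if h : ∃ s : CompositionSeries (Submodule A M), s.head = ⊥ ∧ s.last = ⊤ then
    factorCount h.choose S
  else 0

/-- The multiplicity can be computed from any composition series. -/
theorem jhMultiplicity_eq {A : Type v} {M : Type w} [Ring A] [AddCommGroup M] [Module A M]
    (S : Type u) [AddCommGroup S] [Module A S] (s : CompositionSeries (Submodule A M))
    (hb : s.head = ⊥) (ht : s.last = ⊤) : jhMultiplicity A M S = factorCount s S := by
  have h : ∃ s : CompositionSeries (Submodule A M), s.head = ⊥ ∧ s.last = ⊤ := ⟨s, hb, ht⟩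
  unfold jhMultiplicity
  rw [dif_pos h]
  obtain ⟨f, hf⟩ := CompositionSeries.jordan_holder h.choose s
    (h.choose_spec.1.trans hb.symm) (h.choose_spec.2.trans ht.symm)
  refine Nat.card_congr (f.subtypeEquiv fun i => ?_)
  have e := (hf i).linearEquiv
  exact ⟨fun ⟨g⟩ => ⟨e.symm.trans g⟩, fun ⟨g⟩ => ⟨e.trans g⟩⟩

/-- `M` (finite-dimensional) is *thin* or *squarefree*: `[M : S] ≤ 1` for every simple `S`. -/
def IsThinModule (A : Type v) (M : Type w) [Ring A] [AddCommGroup M] [Module A M] : Prop :=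
  ∀ (S : Type v) [AddCommGroup S] [Module A S], IsSimpleModule A S → jhMultiplicity A M S ≤ 1

/-- `M` (finite-dimensional) is a *1-representation*: `[M : S] = 1` for every simple `S`. -/
def IsOneRepresentation (A : Type v) (M : Type w) [Ring A] [AddCommGroup M] [Module A M] : Prop :=
  ∀ (S : Type v) [AddCommGroup S] [Module A S], IsSimpleModule A S → jhMultiplicity A M S = 1

/-! The idempotents of `K^n` lift to a complete orthogonal system `e i` in `A`. The simple modules
`S i` are indexed by `i`, and `[M : S i] = dim (e i) M`. Everything is read off from these
dimensions.

If `M` is faithful and thin, each `(e i) M` is a line, since `e i ≠ 0` cannot act as zero. So `A`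
embeds in the matrices over `K`, and cutting with the `e i` shows that its image is spanned by
matrix units. The positions that occur form a reflexive and transitive relation, antisymmetric
because elements of the nilpotent radical `J` have zero diagonal. Hence `A` is an incidence algebra
(`Coordinates.nonempty_algEquiv`). Conversely, `K^P` is a faithful thin module over `I(P, K)`.

When all `(e i) M` are lines, every submodule is spanned by some of them, so `M` is distributive. An
arrow from `S j` to `S i` forces `(e i) J (e j) ≠ 0`, hence `i < j`, so `A` is acyclic. In the other
direction, if no path leads from `S j` to `S i`, then `(e i) J (e j) = 0`. For acyclic `A` this
makes `(e i) A (e i) = K (e i)`, and distributivity then leaves no room for two independent vectors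
in `(e i) M` (`exists_span_of_isDistributiveModule`). -/

/-- A complete system of orthogonal idempotents `e i` of a `K`-algebra together with the algebra
homomorphisms `π i` to `K` dual to them, whose common kernel lies in the Jacobson radical. -/
structure PointedFrame (K : Type*) (A : Type*) (ι : Type*) [Field K] [Ring A] [Algebra K A]
    [Fintype ι] where
  e : ι → A
  π : ι → A →ₐ[K] K
  complete : CompleteOrthogonalIdempotents e
  π_self : ∀ i, π i (e i) = 1
  π_ne : ∀ i j, i ≠ j → π i (e j) = 0
  mem_jacobson : ∀ a, (∀ i, π i a = 0) → a ∈ Ring.jacobson A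

/-! ### Simple modules and the characters `π i` -/

namespace PointedFrame

variable {K A ι : Type*} [Field K] [Ring A] [Algebra K A] [Fintype ι] (F : PointedFrame K A ι)

lemma idem (i : ι) : F.e i * F.e i = F.e i := F.complete.idem i

lemma ortho {i j : ι} (h : i ≠ j) : F.e i * F.e j = 0 := F.complete.ortho h

lemma sum_e : ∑ i, F.e i = 1 := F.complete.complete

lemma sum_e_smul {M : Type*} [AddCommGroup M] [Module A M] (m : M) :
    ∑ i, F.e i • m = m := by
  rw [← Finset.sum_smul, F.sum_e, one_smul]

lemma π_eq_zero_of_mem_jacobson {a : A} (ha : a ∈ Ring.jacobson A) (i : ι) : F.π i a = 0 := by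
  have : RingHomSurjective (F.π i : A →+* K) := ⟨fun c => ⟨algebraMap K A c, by simp⟩⟩
  exact IsSemisimpleModule.jacobson_le_ker A K A K (F.π i : A →+* K).toSemilinearMap ha

lemma mul_e_sub_mem (a : A) (i : ι) :
    a * F.e i - algebraMap K A (F.π i a) * F.e i ∈ Ring.jacobson A := by
  refine F.mem_jacobson _ fun j => ?_
  by_cases h : j = i
  · subst h; simp
  · simp [F.π_ne j i h]

lemma e_mul_sub_mem (a : A) (i : ι) :
    F.e i * a - algebraMap K A (F.π i a) * F.e i ∈ Ring.jacobson A := by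
  refine F.mem_jacobson _ fun j => ?_
  by_cases h : j = i
  · subst h; simp [F.π_self]
  · simp [F.π_ne j i h]

/-- `A` acts on `S` through the homomorphism `π i`. -/
def IsOfType (i : ι) (S : Type*) [AddCommGroup S] [Module A S] : Prop :=
  ∀ (a : A) (s : S), a • s = algebraMap K A (F.π i a) • s

/-- The radical kills `S`, so `A` acts through `π i` on any nonzero vector `e i • s`. That vector
generates `S`, and `K` is commutative, so the same holds on all of `S`. -/
lemma exists_isOfType (S : Type*) [AddCommGroup S] [Module A S] [IsSimpleModule A S] :
    ∃ i, F.IsOfType i S := by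
  have hJ : ∀ x ∈ Ring.jacobson A, ∀ s : S, x • s = 0 := fun x hx s =>
    Module.mem_annihilator.1 (IsSemisimpleModule.jacobson_le_annihilator A S hx) s
  have := IsSimpleModule.nontrivial A S
  obtain ⟨s, hs⟩ := exists_ne (0 : S)
  obtain ⟨i, hi⟩ : ∃ i, F.e i • s ≠ 0 := by
    by_contra! h
    exact hs (by rw [← F.sum_e_smul s]; exact Finset.sum_eq_zero fun i _ => h i)
  have key : ∀ a : A, a • F.e i • s = algebraMap K A (F.π i a) • F.e i • s := fun a => by
    have := hJ _ (F.mul_e_sub_mem a i) s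
    rwa [sub_smul, sub_eq_zero, mul_smul, mul_smul] at this
  refine ⟨i, fun a x => ?_⟩
  obtain ⟨b, rfl⟩ := IsSimpleModule.toSpanSingleton_surjective A hi x
  simp only [LinearMap.toSpanSingleton_apply]
  rw [← mul_smul a b, key, key b, map_mul, map_mul, mul_smul]

variable {F} in
lemma IsOfType.e_smul {i : ι} {S : Type*} [AddCommGroup S] [Module A S] (h : F.IsOfType i S)
    (s : S) : F.e i • s = s := by
  rw [h, F.π_self, map_one, one_smul]

variable {F} in
lemma IsOfType.e_smul_ne {i j : ι} {S : Type*} [AddCommGroup S] [Module A S]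
    (h : F.IsOfType i S) (hij : i ≠ j) (s : S) : F.e j • s = 0 := by
  rw [h, F.π_ne i j hij, map_zero, zero_smul]

variable {F} in
lemma IsOfType.smul_eq_zero_iff {i : ι} {S : Type*} [AddCommGroup S] [Module A S]
    (h : F.IsOfType i S) {s : S} (hs : s ≠ 0) (a : A) : a • s = 0 ↔ F.π i a = 0 := by
  constructor
  · intro h0
    by_contra hne
    rw [h] at h0
    apply hs
    rw [← one_smul A s, ← map_one (algebraMap K A), ← inv_mul_cancel₀ hne, map_mul, mul_smul, h0,
      smul_zero]
  · intro h0
    rw [h, h0, map_zero, zero_smul]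

variable {F} in
lemma IsOfType.nonempty_linearEquiv {i : ι} {S T : Type*} [AddCommGroup S] [Module A S]
    [AddCommGroup T] [Module A T] [IsSimpleModule A S] [IsSimpleModule A T]
    (hS : F.IsOfType i S) (hT : F.IsOfType i T) : Nonempty (S ≃ₗ[A] T) := by
  have := IsSimpleModule.nontrivial A S
  have := IsSimpleModule.nontrivial A T
  obtain ⟨s, hs⟩ := exists_ne (0 : S)
  obtain ⟨t, ht⟩ := exists_ne (0 : T)
  -- Both vectors have annihilator `ker (π i)`, so both modules are the same cyclic quotient of `A`.
  have hk : LinearMap.ker (LinearMap.toSpanSingleton A S s) =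
      LinearMap.ker (LinearMap.toSpanSingleton A T t) := by
    ext a
    simp [hS.smul_eq_zero_iff hs, hT.smul_eq_zero_iff ht]
  exact ⟨((LinearMap.toSpanSingleton A S s).quotKerEquivOfSurjective
      (IsSimpleModule.toSpanSingleton_surjective A hs)).symm.trans
    ((Submodule.quotEquivOfEq _ _ hk).trans
      ((LinearMap.toSpanSingleton A T t).quotKerEquivOfSurjective
        (IsSimpleModule.toSpanSingleton_surjective A ht)))⟩

variable {F} in
lemma IsOfType.of_linearEquiv {i : ι} {S T : Type*} [AddCommGroup S] [Module A S]
    [AddCommGroup T] [Module A T] (hS : F.IsOfType i S) (f : S ≃ₗ[A] T) : F.IsOfType i T := by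
  intro a t
  obtain ⟨s, rfl⟩ := f.surjective t
  rw [← map_smul, hS, map_smul]

variable {F} in
lemma IsOfType.unique {i j : ι} {S : Type*} [AddCommGroup S] [Module A S] [Nontrivial S]
    (hi : F.IsOfType i S) (hj : F.IsOfType j S) : i = j := by
  by_contra h
  obtain ⟨s, hs⟩ := exists_ne (0 : S)
  exact hs (by rw [← hj.e_smul s, hi.e_smul_ne h])

end PointedFrame

/-! ### Additivity of `dim e M` for an idempotent `e` -/

section Peirce

variable (K : Type*) {A : Type*} [Field K] [Ring A] [Algebra K A]

/-- The subspace `a M` of `M`. -/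
abbrev smulRange (a : A) (M : Type*) [AddCommGroup M] [Module K M] [Module A M]
    [IsScalarTower K A M] : Submodule K M :=
  LinearMap.range (Algebra.lsmul K K M a)

variable (M : Type*) [AddCommGroup M] [Module K M] [Module A M] [IsScalarTower K A M]

variable {M} in
lemma mem_smulRange_iff {e : A} (he : e * e = e) (m : M) : m ∈ smulRange K e M ↔ e • m = m := by
  constructor
  · rintro ⟨x, rfl⟩
    simp [smul_smul, he]
  · intro h
    exact ⟨m, h⟩

variable {M} in
-- Cutting with an idempotent is exact: the projection `e M → M ⧸ N` has image `e (M ⧸ N)` and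
-- kernel `e N`.
lemma finrank_smulRange_add [FiniteDimensional K M] {e : A} (he : e * e = e)
    (N : Submodule A M) :
    Module.finrank K (smulRange K e M) =
      Module.finrank K (smulRange K e N) + Module.finrank K (smulRange K e (M ⧸ N)) := by
  let g : smulRange K e M →ₗ[K] M ⧸ N := (N.mkQ.restrictScalars K).domRestrict (smulRange K e M)
  have h := LinearMap.finrank_range_add_finrank_ker g
  have h1 : LinearMap.range g = smulRange K e (M ⧸ N) := by
    ext x
    rw [mem_smulRange_iff K he]
    constructor
    · rintro ⟨⟨m, hm⟩, rfl⟩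
      rw [mem_smulRange_iff K he] at hm
      change e • N.mkQ m = N.mkQ m
      rw [← map_smul, hm]
    · intro hx
      obtain ⟨m, rfl⟩ := N.mkQ_surjective x
      refine ⟨⟨e • m, ⟨m, rfl⟩⟩, ?_⟩
      change N.mkQ (e • m) = _
      rw [map_smul, hx]
  have h2 : Module.finrank K (LinearMap.ker g) = Module.finrank K (smulRange K e N) := by
    let f : smulRange K e N →ₗ[K] smulRange K e M :=
      ((N.subtype.restrictScalars K).domRestrict (smulRange K e N)).codRestrict _ (by
        rintro ⟨n, hn⟩
        rw [mem_smulRange_iff K he] at hn ⊢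
        change e • (n : M) = n
        rw [← Submodule.coe_smul, hn])
    have hf : Function.Injective f := by
      intro x y hxy
      have := congrArg (fun z : smulRange K e M => (z : M)) hxy
      exact Subtype.ext (Subtype.ext this)
    have hr : LinearMap.range f = LinearMap.ker g := by
      ext ⟨m, hm⟩
      rw [mem_smulRange_iff K he] at hm
      constructor
      · rintro ⟨⟨⟨n, hn⟩, hn'⟩, h⟩
        have : n = m := congrArg (fun z : smulRange K e M => (z : M)) h
        subst this
        exact (Submodule.Quotient.mk_eq_zero N).2 hn
      · intro h
        have hmN : m ∈ N := (Submodule.Quotient.mk_eq_zero N).1 h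
        refine ⟨⟨⟨m, hmN⟩, ?_⟩, rfl⟩
        rw [mem_smulRange_iff K he]
        exact Subtype.ext hm
    rw [← hr, LinearMap.finrank_range_of_inj hf]
  rw [← h, h1, h2, add_comm]

variable {M} in
lemma finrank_smulRange_congr {N : Type*} [AddCommGroup N] [Module K N] [Module A N]
    [IsScalarTower K A N] (e : A) (f : M ≃ₗ[A] N) :
    Module.finrank K (smulRange K e M) = Module.finrank K (smulRange K e N) := by
  have : smulRange K e N = (smulRange K e M).map (f.restrictScalars K : M →ₗ[K] N) := by
    ext x
    constructor
    · rintro ⟨y, rfl⟩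
      exact ⟨e • f.symm y, ⟨_, rfl⟩, by simp⟩
    · rintro ⟨_, ⟨y, rfl⟩, rfl⟩
      exact ⟨f y, by simp⟩
  rw [this]
  exact ((f.restrictScalars K).finrank_map_eq _).symm

variable {M} in
lemma finrank_smulRange_compositionSeries [FiniteDimensional K M] {e : A} (he : e * e = e)
    (s : CompositionSeries (Submodule A M)) (hb : s.head = ⊥) (k : Fin (s.length + 1)) :
    Module.finrank K (smulRange K e (s k)) = ∑ i : Fin s.length, if i.castSucc < k then
      Module.finrank K (smulRange K e (s i.succ ⧸ (s i.castSucc).submoduleOf (s i.succ)))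
      else 0 := by
  induction k using Fin.induction with
  | zero =>
    have h0 : s 0 = ⊥ := hb
    have : Subsingleton (s 0) := by rw [h0]; infer_instance
    rw [Finset.sum_eq_zero fun i _ => if_neg (by simp)]
    exact Module.finrank_zero_of_subsingleton
  | succ k ih =>
    have hle : s k.castSucc ≤ s k.succ := (s.strictMono (Fin.castSucc_lt_succ)).le
    have : FiniteDimensional K (s k.succ) :=
      FiniteDimensional.finiteDimensional_submodule ((s k.succ).restrictScalars K)
    rw [finrank_smulRange_add K he ((s k.castSucc).submoduleOf (s k.succ)),
      finrank_smulRange_congr K e (Submodule.submoduleOfEquivOfLe hle), ih]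
    have : ∀ i : Fin s.length, (if i.castSucc < k.succ then
        Module.finrank K (smulRange K e (s i.succ ⧸ (s i.castSucc).submoduleOf (s i.succ)))
        else 0) = (if i.castSucc < k.castSucc then
        Module.finrank K (smulRange K e (s i.succ ⧸ (s i.castSucc).submoduleOf (s i.succ)))
        else 0) + if i = k then
        Module.finrank K (smulRange K e (s k.succ ⧸ (s k.castSucc).submoduleOf (s k.succ)))
        else 0 := by
      intro i
      rcases lt_trichotomy i k with h | h | h
      · simp only [Fin.lt_def, Fin.val_castSucc, Fin.val_succ] at h ⊢
        rw [if_pos (by omega), if_pos (by omega), if_neg (by rintro rfl; omega), add_zero]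
      · subst h; simp
      · simp only [Fin.lt_def, Fin.val_castSucc, Fin.val_succ] at h ⊢
        rw [if_neg (by omega), if_neg (by omega), if_neg (by rintro rfl; omega)]
    rw [Finset.sum_congr rfl fun i _ => this i, Finset.sum_add_distrib, Finset.sum_ite_eq']
    simp

end Peirce

/-! ### Multiplicities as dimensions of Peirce components -/

namespace PointedFrame

variable {K A ι : Type*} [Field K] [Ring A] [Algebra K A] [Fintype ι] {F : PointedFrame K A ι}

lemma IsOfType.finrank_smulRange {i : ι} {S : Type*} [AddCommGroup S] [Module K S] [Module A S]
    [IsScalarTower K A S] [IsSimpleModule A S] (h : F.IsOfType i S) :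
    Module.finrank K (smulRange K (F.e i) S) = 1 := by
  have := IsSimpleModule.nontrivial A S
  have ht : smulRange K (F.e i) S = ⊤ := by
    rw [eq_top_iff]
    exact fun s _ => ⟨s, h.e_smul s⟩
  rw [ht, finrank_top]
  obtain ⟨s, hs⟩ := exists_ne (0 : S)
  refine finrank_eq_one s hs fun t => ?_
  obtain ⟨a, rfl⟩ := IsSimpleModule.toSpanSingleton_surjective A hs t
  exact ⟨F.π i a, by rw [LinearMap.toSpanSingleton_apply, h a s, algebraMap_smul]⟩

lemma IsOfType.finrank_smulRange_ne {i j : ι} {S : Type*} [AddCommGroup S] [Module K S]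
    [Module A S] [IsScalarTower K A S] (h : F.IsOfType i S) (hij : i ≠ j) :
    Module.finrank K (smulRange K (F.e j) S) = 0 := by
  have : smulRange K (F.e j) S = ⊥ := by
    rw [eq_bot_iff]
    rintro _ ⟨s, rfl⟩
    exact h.e_smul_ne hij s
  rw [this, finrank_bot]

/-- The Jordan–Hölder multiplicity of the simple module of type `i` in `M` is `dim (e i) M`. -/
lemma IsOfType.jhMultiplicity_eq {i : ι} {M S : Type*} [AddCommGroup M] [Module K M] [Module A M]
    [IsScalarTower K A M] [FiniteDimensional K M] [AddCommGroup S] [Module A S]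
    [IsSimpleModule A S] (h : F.IsOfType i S) :
    jhMultiplicity A M S = Module.finrank K (smulRange K (F.e i) M) := by
  classical
  have : IsNoetherian A M := isNoetherian_of_tower K inferInstance
  have : IsArtinian A M := isArtinian_of_tower K inferInstance
  obtain ⟨s, hb, ht⟩ := exists_compositionSeries_of_isNoetherian_isArtinian A M
  have hl : s (Fin.last s.length) = ⊤ := ht
  rw [_root_.jhMultiplicity_eq S s hb ht, factorCount, Nat.card_eq_fintype_card,
    Fintype.card_subtype, Finset.card_filter]
  have := finrank_smulRange_compositionSeries K (F.idem i) s hb (Fin.last _)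
  rw [finrank_smulRange_congr K (F.e i) ((LinearEquiv.ofEq _ _ hl).trans Submodule.topEquiv)]
    at this
  rw [this]
  refine Finset.sum_congr rfl fun k _ => ?_
  rw [if_pos (Fin.castSucc_lt_last k)]
  have hsimp : IsSimpleModule A (s k.succ ⧸ (s k.castSucc).submoduleOf (s k.succ)) := by
    have := s.step k
    exact (covBy_iff_quot_is_simple (s.strictMono (Fin.castSucc_lt_succ)).le).1 this
  obtain ⟨j, hj⟩ := F.exists_isOfType (s k.succ ⧸ (s k.castSucc).submoduleOf (s k.succ))
  -- A factor of type `j` contributes 1 to `dim (e i) M` if `j = i` and 0 otherwise, so the sum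
  -- counts the factors isomorphic to `S`.
  by_cases hij : j = i
  · subst hij
    rw [if_pos (hj.nonempty_linearEquiv h), hj.finrank_smulRange]
  · rw [hj.finrank_smulRange_ne hij, if_neg]
    rintro ⟨f⟩
    have := IsSimpleModule.nontrivial A S
    exact hij ((hj.of_linearEquiv f).unique h)

end PointedFrame

/-! ### `Ext¹` from a projective presentation -/

section ExtOne

open CategoryTheory Abelian

/-- For a surjection `p` of a projective module onto `S`, the group `Ext¹(S, T)` vanishes if and
only if all homomorphisms `ker p → T` extend. -/
lemma nontrivial_ext_one_iff {A : Type v} [Ring A] {P : Type v} [AddCommGroup P] [Module A P]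
    [Module.Projective A P] (S T : ModuleCat.{v} A) (p : P →ₗ[A] S) (hp : Function.Surjective p) :
    Nontrivial (Ext.{v} S T 1) ↔
      ∃ h : LinearMap.ker p →ₗ[A] T, ∀ g : P →ₗ[A] T, g ∘ₗ (LinearMap.ker p).subtype ≠ h := by
  have hS := LinearMap.shortExact_shortComplexKer hp
  have : Projective p.shortComplexKer.X₂ := inferInstanceAs (Projective (ModuleCat.of A P))
  constructor
  · intro hn
    obtain ⟨x, hx⟩ := exists_ne (0 : Ext.{v} S T 1)
    obtain ⟨y, hy⟩ := Ext.contravariant_sequence_exact₃ hS T x (Ext.eq_zero_of_projective _)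
      (add_zero 1)
    obtain ⟨f, rfl⟩ := (Ext.mk₀_bijective _ _).2 y
    refine ⟨f.hom, fun g hg => hx ?_⟩
    have : f = p.shortComplexKer.f ≫ (ModuleCat.ofHom g : p.shortComplexKer.X₂ ⟶ T) := by
      ext z
      exact (LinearMap.congr_fun hg z).symm
    -- The class `x` is the extension class followed by `f`; once `f` factors through the inclusion
    -- of the kernel, the composite is zero.
    rw [← hy, this, ← Ext.mk₀_comp_mk₀, ShortComplex.ShortExact.extClass_comp_assoc]
  · rintro ⟨h, hh⟩
    by_contra hn
    rw [not_nontrivial_iff_subsingleton] at hn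
    obtain ⟨y, hy⟩ := Ext.contravariant_sequence_exact₁ hS T
      (Ext.mk₀ (ModuleCat.ofHom h : p.shortComplexKer.X₁ ⟶ T)) (add_zero 1)
      (Subsingleton.elim (α := Ext.{v} S T 1) _ _)
    obtain ⟨g, rfl⟩ := (Ext.mk₀_bijective _ _).2 y
    rw [Ext.mk₀_comp_mk₀] at hy
    have := (Ext.mk₀_bijective _ _).1 hy
    refine hh g.hom ?_
    ext z
    exact LinearMap.congr_fun (congrArg ModuleCat.Hom.hom this) z

end ExtOne

/-! ### Arrows of the `Ext` quiver and the radical -/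

namespace PointedFrame

variable {K : Type u} {A : Type v} {ι : Type*} [Field K] [Ring A] [Algebra K A] [Fintype ι]
  {F : PointedFrame K A ι}

lemma mul_e_mem_jacobson {j : ι} {m : A} (hm : F.π j m = 0) : m * F.e j ∈ Ring.jacobson A := by
  refine F.mem_jacobson _ fun l => ?_
  by_cases hl : l = j
  · subst hl; simp [hm]
  · simp [F.π_ne l j hl]

/-- If `(e i) J (e j) = 0`, then every homomorphism `f` from `ker (π j)` to `T` kills `m * e j`,
because `e i` acts as the identity on `T`. Hence `f` extends to `A` by `a ↦ a • f (1 - e j)`, and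
`Ext¹` vanishes. -/
lemma IsOfType.exists_of_extArrow {i j : ι} {S T : SimpleModules A}
    (hS : F.IsOfType j S.1) (hT : F.IsOfType i T.1) (h : ExtArrow A S T) :
    ∃ x ∈ Ring.jacobson A, F.e i * x * F.e j ≠ 0 := by
  have := S.2
  have := IsSimpleModule.nontrivial A S.1
  obtain ⟨s, hs⟩ := exists_ne (0 : S.1)
  set p := LinearMap.toSpanSingleton A S.1 s with hp
  obtain ⟨f, hf⟩ := (nontrivial_ext_one_iff S.1 T.1 p
    (IsSimpleModule.toSpanSingleton_surjective A hs)).1 h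
  have hker : ∀ a, a ∈ LinearMap.ker p ↔ F.π j a = 0 := fun a =>
    hS.smul_eq_zero_iff hs a
  by_contra! h0
  have h1 : 1 - F.e j ∈ LinearMap.ker p := by
    rw [hker, map_sub, map_one, F.π_self, sub_self]
  refine hf (LinearMap.toSpanSingleton A T.1 (f ⟨1 - F.e j, h1⟩)) ?_
  ext ⟨m, hm⟩
  have hm' := (hker m).1 hm
  have h2 := F.mul_e_mem_jacobson hm'
  have h3 : m * F.e j ∈ LinearMap.ker p := by
    rw [hker]; exact F.π_eq_zero_of_mem_jacobson h2 j
  have h4 : f ⟨m * F.e j, h3⟩ = 0 := by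
    rw [← hT.e_smul (f _), ← map_smul]
    have h5 := h0 _ h2
    rw [mul_assoc, mul_assoc, F.idem] at h5
    rw [show F.e i • (⟨m * F.e j, h3⟩ : LinearMap.ker p) = 0 from Subtype.ext h5, map_zero]
  have h5 : (⟨m, hm⟩ : LinearMap.ker p) = m • ⟨1 - F.e j, h1⟩ + ⟨m * F.e j, h3⟩ := by
    ext
    simp [mul_sub]
  change m • f ⟨1 - F.e j, h1⟩ = f ⟨m, hm⟩
  rw [h5, map_add, map_smul, h4, add_zero]

/-- The one-dimensional simple module of type `i`. -/
abbrev simpleQuotient (F : PointedFrame K A ι) (i : ι) : Type v :=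
  A ⧸ (RingHom.ker (F.π i) : Ideal A)

lemma isOfType_simpleQuotient (i : ι) : F.IsOfType i (F.simpleQuotient i) := by
  intro a s
  obtain ⟨b, rfl⟩ := Submodule.Quotient.mk_surjective _ s
  rw [← Submodule.Quotient.mk_smul, ← Submodule.Quotient.mk_smul, Submodule.Quotient.eq]
  change F.π i _ = 0
  simp

lemma isSimpleModule_simpleQuotient (i : ι) : IsSimpleModule A (F.simpleQuotient i) := by
  have hne : Nontrivial (F.simpleQuotient i) := by
    rw [Submodule.Quotient.nontrivial_iff, Ne, Ideal.eq_top_iff_one]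
    change F.π i 1 ≠ 0
    simp
  rw [isSimpleModule_iff_toSpanSingleton_surjective]
  refine ⟨hne, fun s hs t => ?_⟩
  obtain ⟨a, rfl⟩ := Submodule.Quotient.mk_surjective _ s
  obtain ⟨b, rfl⟩ := Submodule.Quotient.mk_surjective _ t
  have ha : F.π i a ≠ 0 := fun h => hs ((Submodule.Quotient.mk_eq_zero _).2 h)
  refine ⟨algebraMap K A (F.π i b * (F.π i a)⁻¹), ?_⟩
  rw [LinearMap.toSpanSingleton_apply, ← Submodule.Quotient.mk_smul, Submodule.Quotient.eq]
  change F.π i _ = 0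
  simp [ha]

/-- The vertex of the `Ext` quiver given by `i`. -/
def simple (F : PointedFrame K A ι) (i : ι) : SimpleModules A :=
  ⟨ModuleCat.of A (F.simpleQuotient i), F.isSimpleModule_simpleQuotient i⟩

/-- A linear form on `A` which vanishes on the square of the radical gives a homomorphism from the
maximal left ideal of type `j` to the simple module of type `i`. -/
noncomputable def kerToSimpleQuotient (F : PointedFrame K A ι) (i j : ι) (φ : Module.Dual K A)
    (hφ : ∀ a ∈ Ring.jacobson A * Ring.jacobson A, φ a = 0) :
    (RingHom.ker (F.π j) : Ideal A) →ₗ[A] F.simpleQuotient i where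
  toFun m := Submodule.Quotient.mk (algebraMap K A (φ (F.e i * m * F.e j)))
  map_add' a b := by
    simp [mul_add, add_mul]
  map_smul' a m := by
    have h1 : φ (F.e i * (a * m) * F.e j) = F.π i a * φ (F.e i * m * F.e j) := by
      -- Both factors lie in the radical, so `φ` vanishes on their product.
      have h2 := hφ _ (Ideal.mul_mem_mul (F.e_mul_sub_mem a i) (F.mul_e_mem_jacobson m.2))
      rw [sub_mul, map_sub, sub_eq_zero] at h2
      rw [← smul_eq_mul (F.π i a), ← map_smul, Algebra.smul_def]
      simpa only [mul_assoc] using h2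
    simp only [SetLike.val_smul, smul_eq_mul, h1, RingHom.id_apply]
    rw [F.isOfType_simpleQuotient i a, ← Submodule.Quotient.mk_smul, map_mul, smul_eq_mul]

/-- Choose a linear form `φ` that separates `e i * x * e j` from `J * J`. The homomorphism it
defines does not extend to `A`: a homomorphism from `A` to a simple module kills `J`, whereas this
one is nonzero at `e i * x * e j`. -/
lemma extArrow_of_notMem_sq {i j : ι} {x : A} (hx : x ∈ Ring.jacobson A)
    (h : F.e i * x * F.e j ∉ Ring.jacobson A * Ring.jacobson A) :
    ExtArrow A (F.simple j) (F.simple i) := by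
  set J := Ring.jacobson A
  obtain ⟨φ, hφ, hφJ⟩ := Submodule.exists_dual_map_eq_bot_of_notMem
    (p := (J * J).restrictScalars K) h inferInstance
  replace hφJ : ∀ a ∈ J * J, φ a = 0 := fun a ha => by
    have : φ a ∈ ((J * J).restrictScalars K).map φ := ⟨a, ha, rfl⟩
    rwa [hφJ] at this
  have hy : F.e i * x * F.e j ∈ J := Ideal.mul_mem_right _ _ (Ideal.mul_mem_left _ _ hx)
  have key : ∀ g : A →ₗ[A] F.simpleQuotient i,
      ∃ m : (RingHom.ker (F.π j) : Ideal A), g m ≠ F.kerToSimpleQuotient i j φ hφJ m := by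
    refine fun g => ⟨⟨F.e i * x * F.e j, F.π_eq_zero_of_mem_jacobson hy j⟩, fun h1 => ?_⟩
    have h2 : g (F.e i * x * F.e j) = 0 := by
      have : g (F.e i * x * F.e j) = (F.e i * x * F.e j) • g 1 := by
        rw [← map_smul, smul_eq_mul, mul_one]
      rw [this, F.isOfType_simpleQuotient i, F.π_eq_zero_of_mem_jacobson hy i, map_zero, zero_smul]
    rw [h2] at h1
    have h3 := (Submodule.Quotient.mk_eq_zero (RingHom.ker (F.π i) : Ideal A)).1 h1.symm
    rw [RingHom.mem_ker, AlgHom.commutes, ← mul_assoc, ← mul_assoc, F.idem, mul_assoc _ (F.e j),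
      F.idem] at h3
    exact hφ h3
  let p : A →ₗ[A] F.simpleQuotient j := Submodule.mkQ (RingHom.ker (F.π j) : Ideal A)
  have hker : LinearMap.ker p = (RingHom.ker (F.π j) : Ideal A) := Submodule.ker_mkQ _
  refine (nontrivial_ext_one_iff (F.simple j).1 (F.simple i).1 p (Submodule.mkQ_surjective _)).2
    ⟨F.kerToSimpleQuotient i j φ hφJ ∘ₗ (LinearEquiv.ofEq _ _ hker).toLinearMap, fun g hg => ?_⟩
  obtain ⟨m, hm⟩ := key g
  exact hm (LinearMap.congr_fun hg ⟨m, hker.ge m.2⟩)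

/-- By induction `(e i) J (e j)` lies in every power of the nilpotent ideal `J`. Without an arrow it
lies in `J * J`; inserting `1 = ∑ e l` between two factors, for each `l` a path is missing either
from `j` to `l` or from `l` to `i`, and the induction hypothesis improves that factor. -/
lemma e_mul_e_eq_zero_of_not_transGen [IsArtinianRing A] {i j : ι}
    (hij : ¬ Relation.TransGen (ExtArrow A) (F.simple j) (F.simple i)) {x : A}
    (hx : x ∈ Ring.jacobson A) : F.e i * x * F.e j = 0 := by
  set J := Ring.jacobson A with hJdef
  have hJ : ∀ a b, a ∈ J → a * b ∈ J := fun a b ha => Ideal.mul_mem_right b _ ha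
  have key : ∀ k : ℕ, ∀ i j : ι,
      ¬ Relation.TransGen (ExtArrow A) (F.simple j) (F.simple i) →
      ∀ x ∈ J, F.e i * x * F.e j ∈ J ^ (k + 1) := by
    intro k
    induction k with
    | zero =>
      intro i j _ x hx
      rw [zero_add, Submodule.pow_one]
      exact hJ _ _ (Ideal.mul_mem_left _ _ hx)
    | succ k ih =>
      intro i j hij x hx
      have h2 : F.e i * x * F.e j ∈ J * J := by
        by_contra h
        exact hij (Relation.TransGen.single (extArrow_of_notMem_sq hx h))
      have h3 : ∀ y ∈ J * J, F.e i * y * F.e j ∈ J ^ (k + 1 + 1) := by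
        intro y hy
        refine Submodule.mul_induction_on hy ?_ ?_
        · intro a ha b hb
          have : F.e i * (a * b) * F.e j = ∑ l, (F.e i * a * F.e l) * (F.e l * b * F.e j) := by
            have h4 : ∀ l, (F.e i * a * F.e l) * (F.e l * b * F.e j) =
                F.e i * a * F.e l * (b * F.e j) := fun l => by
              rw [mul_assoc (F.e l), mul_assoc (F.e i * a), ← mul_assoc (F.e l) (F.e l), F.idem,
                ← mul_assoc (F.e i * a)]
            simp_rw [h4]
            rw [← Finset.sum_mul, ← Finset.mul_sum, F.sum_e, mul_one]
            simp only [mul_assoc]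
          rw [this]
          refine Ideal.sum_mem _ fun l _ => ?_
          by_cases hjl : Relation.TransGen (ExtArrow A) (F.simple j) (F.simple l)
          · have hli : ¬ Relation.TransGen (ExtArrow A) (F.simple l) (F.simple i) :=
              fun h => hij (hjl.trans h)
            rw [Submodule.pow_succ]
            exact Ideal.mul_mem_mul (ih i l hli a ha) (hJ _ _ (Ideal.mul_mem_left _ _ hb))
          · rw [Submodule.pow_succ' J k.succ_ne_zero]
            exact Ideal.mul_mem_mul (hJ _ _ (Ideal.mul_mem_left _ _ ha)) (ih l j hjl b hb)
        · intro a b ha hb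
          rw [mul_add, add_mul]
          exact Ideal.add_mem _ ha hb
      have h4 := h3 _ h2
      rwa [← mul_assoc, ← mul_assoc, F.idem, mul_assoc _ (F.e j), F.idem] at h4
  obtain ⟨n, hn⟩ := IsSemiprimaryRing.isNilpotent (R := A)
  have h1 := Ideal.pow_le_pow_right (Nat.le_succ n) (key n i j hij x hx)
  rw [← hJdef] at hn
  rw [hn] at h1
  exact h1

end PointedFrame

/-! ### Existence and transport of frames -/

/-- The radical is nilpotent, so the standard idempotents of `K^n` lift along `A → A / J(A) ≅ K^n`;
the `π i` are the coordinates of this map. -/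
theorem IsBasicPointed.exists_pointedFrame {K : Type u} {A : Type v} [Field K] [Ring A]
    [Algebra K A] [FiniteDimensional K A] (hA : IsBasicPointed K A) :
    ∃ n : ℕ, Nonempty (PointedFrame K A (Fin n)) := by
  obtain ⟨n, ⟨φ⟩⟩ := hA
  have : IsArtinianRing A := IsArtinianRing.of_finite K A
  let f : A →ₐ[K] (Fin n → K) := φ.toAlgHom.comp (Ideal.Quotient.mkₐ K (Ring.jacobson A))
  have hf : ∀ a, f a = 0 ↔ a ∈ Ring.jacobson A := fun a => by
    rw [← Ideal.Quotient.eq_zero_iff_mem]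
    exact map_eq_zero_iff φ φ.injective
  have hsurj : Function.Surjective f :=
    φ.surjective.comp (Ideal.Quotient.mkₐ_surjective K _)
  have hnil : ∀ x ∈ RingHom.ker (f : A →+* (Fin n → K)), IsNilpotent x := fun x hx => by
    obtain ⟨k, hk⟩ := IsSemiprimaryRing.isNilpotent (R := A)
    have := Ideal.pow_mem_pow ((hf x).1 hx) k
    rw [hk] at this
    exact ⟨k, this⟩
  obtain ⟨e, he, hfe⟩ := CompleteOrthogonalIdempotents.lift_of_isNilpotent_ker
    (f : A →+* (Fin n → K)) hnil (CompleteOrthogonalIdempotents.single fun _ : Fin n => K)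
    fun i => hsurj _
  have hfe' : ∀ i, f (e i) = Pi.single i 1 := fun i => congrFun hfe i
  exact ⟨n, ⟨{
    e := e
    π := fun i => (Pi.evalAlgHom K (fun _ => K) i).comp f
    complete := he
    π_self := fun i => by simp [hfe']
    π_ne := fun i j hij => by simp [hfe', hij]
    mem_jacobson := fun a ha => (hf a).1 (funext ha) }⟩⟩

/-- Transport of a frame along an isomorphism. -/
def PointedFrame.map {K A B ι : Type*} [Field K] [Ring A] [Algebra K A] [Ring B] [Algebra K B]
    [Fintype ι] (F : PointedFrame K A ι) (φ : A ≃ₐ[K] B) : PointedFrame K B ι where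
  e i := φ (F.e i)
  π i := (F.π i).comp φ.symm.toAlgHom
  complete := F.complete.map (φ : A →+* B)
  π_self i := by simpa using F.π_self i
  π_ne i j h := by simpa using F.π_ne i j h
  mem_jacobson b hb := by
    have h1 : φ.symm b ∈ Ring.jacobson A := F.mem_jacobson _ hb
    have : RingHomSurjective (φ : A →+* B) := ⟨φ.surjective⟩
    have := Module.le_comap_jacobson (φ : A →+* B).toSemilinearMap h1
    rw [Submodule.mem_comap] at this
    simpa using this

/-! ### The frame of an incidence algebra and its module `K^P` -/

namespace IncidenceAlgebra

variable {K P : Type*} [Field K] [PartialOrder P] [Fintype P] [LocallyFiniteOrder P]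
  [DecidableEq P]

omit [DecidableEq P] in
lemma mul_apply_eq_sum (f g : IncidenceAlgebra K P) (a b : P) :
    (f * g) a b = ∑ x, f a x * g x b := by
  rw [mul_apply]
  refine Finset.sum_subset (Finset.subset_univ _) fun x _ hx => ?_
  rw [Finset.mem_Icc, not_and_or] at hx
  rcases hx with h | h
  · rw [apply_eq_zero_of_not_le h, zero_mul]
  · rw [apply_eq_zero_of_not_le h, mul_zero]

omit [Fintype P] [DecidableEq P] in
lemma mul_apply_self (f g : IncidenceAlgebra K P) (a : P) :
    (f * g) a a = f a a * g a a := by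
  rw [mul_apply, Finset.Icc_self, Finset.sum_singleton]

variable (K) in
/-- The diagonal idempotent at `x`. -/
def diagSingle (x : P) : IncidenceAlgebra K P :=
  ⟨fun a b => if a = x ∧ b = x then 1 else 0, fun a b h => if_neg (by
    rintro ⟨rfl, rfl⟩; exact h le_rfl)⟩

omit [Fintype P] [LocallyFiniteOrder P] in
lemma diagSingle_apply (x a b : P) :
    diagSingle K x a b = if a = x ∧ b = x then 1 else 0 := rfl

lemma diagSingle_mul_apply (x : P) (f : IncidenceAlgebra K P) (a b : P) :
    (diagSingle K x * f) a b = if a = x then f a b else 0 := by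
  rw [mul_apply_eq_sum, Finset.sum_eq_single x]
  · by_cases h : a = x
    · subst h; simp [diagSingle_apply]
    · simp [diagSingle_apply, h]
  · intro y _ hy
    simp [diagSingle_apply, hy]
  · simp

lemma mul_diagSingle_apply (x : P) (f : IncidenceAlgebra K P) (a b : P) :
    (f * diagSingle K x) a b = if b = x then f a b else 0 := by
  rw [mul_apply_eq_sum, Finset.sum_eq_single x]
  · by_cases h : b = x
    · subst h; simp [diagSingle_apply]
    · simp [diagSingle_apply, h]
  · intro y _ hy
    simp [diagSingle_apply, hy]
  · simp

omit [Fintype P] [LocallyFiniteOrder P] [DecidableEq P] in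
lemma sum_apply {α : Type*} (s : Finset α) (f : α → IncidenceAlgebra K P) (a b : P) :
    (∑ i ∈ s, f i) a b = ∑ i ∈ s, f i a b := by
  classical
  induction s using Finset.induction_on with
  | empty => simp
  | insert i s hi ih => rw [Finset.sum_insert hi, Finset.sum_insert hi, add_apply, ih]

lemma completeOrthogonalIdempotents_diagSingle :
    CompleteOrthogonalIdempotents (diagSingle K : P → IncidenceAlgebra K P) where
  idem x := by
    ext a b _
    rw [diagSingle_mul_apply, diagSingle_apply]
    by_cases h : a = x <;> simp [h]
  ortho x y hxy := by
    ext a b _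
    change (diagSingle K x * diagSingle K y) a b = _
    rw [diagSingle_mul_apply, diagSingle_apply, zero_apply]
    by_cases h : a = x
    · subst h; simp [hxy]
    · simp [h]
  complete := by
    ext a b _
    rw [sum_apply, one_apply, Finset.sum_eq_single a]
    · simp [diagSingle_apply, eq_comm]
    · intro c _ hc
      simp [diagSingle_apply, hc.symm]
    · simp

/-- For a maximal left ideal `m`, take `y` minimal such that some `diagSingle K y * b` is outside
`m`. Its class generates the quotient by `m`, and by minimality any `c` with `c y y = 0` kills it:
left multiplication by `c` only reaches components at `z < y`. -/
lemma mem_jacobson_of_forall_apply_self_eq_zero (a : IncidenceAlgebra K P)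
    (ha : ∀ x, a x x = 0) : a ∈ Ring.jacobson (IncidenceAlgebra K P) := by
  refine Submodule.mem_sInf.2 fun m (hm : IsCoatom m) => ?_
  have hsum : ∀ c : IncidenceAlgebra K P, c = ∑ x, diagSingle K x * c := fun c => by
    rw [← Finset.sum_mul, completeOrthogonalIdempotents_diagSingle.complete, one_mul]
  have hne : {y : P | ∃ b, diagSingle K y * b ∉ m}.Nonempty := by
    by_contra! h
    refine hm.1 (m.eq_top_iff'.2 fun c => ?_)
    rw [hsum c]
    refine Submodule.sum_mem _ fun x _ => ?_
    by_contra hx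
    have : x ∈ {y : P | ∃ b, diagSingle K y * b ∉ m} := ⟨c, hx⟩
    rw [h] at this
    exact this
  obtain ⟨y, ⟨b, hb⟩, hmin⟩ := (Set.toFinite _).exists_minimal hne
  have hker : ∀ c : IncidenceAlgebra K P, c y y = 0 → c * (diagSingle K y * b) ∈ m := by
    intro c hc
    rw [hsum (c * _)]
    refine Submodule.sum_mem _ fun z _ => ?_
    by_cases hzy : z ≤ y ∧ z ≠ y
    · by_contra hz
      exact hzy.2 (le_antisymm hzy.1 (hmin ⟨_, hz⟩ hzy.1))
    · have : diagSingle K z * (c * diagSingle K y) = 0 := by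
        ext i j hij
        rw [diagSingle_mul_apply, mul_diagSingle_apply, zero_apply]
        split_ifs with h1 h2
        · subst h1 h2
          rw [not_and_not_right] at hzy
          obtain rfl := hzy hij
          exact hc
        · rfl
        · rfl
      rw [← mul_assoc, ← mul_assoc, mul_assoc (diagSingle K z), this, zero_mul]
      exact m.zero_mem
  have htop : m ⊔ Submodule.span (IncidenceAlgebra K P) {diagSingle K y * b} = ⊤ := by
    refine hm.2 _ (lt_of_le_of_ne le_sup_left fun h => hb ?_)
    rw [h]
    exact Submodule.mem_sup_right (Submodule.mem_span_singleton_self _)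
  obtain ⟨p, hp, q, hq, hpq⟩ := Submodule.mem_sup.1
    (show (1 : IncidenceAlgebra K P) ∈ _ from htop ▸ Submodule.mem_top)
  obtain ⟨d, rfl⟩ := Submodule.mem_span_singleton.1 hq
  rw [← mul_one a, ← hpq, mul_add]
  refine m.add_mem (m.smul_mem a hp) ?_
  rw [smul_eq_mul, ← mul_assoc a]
  exact hker _ (by rw [mul_apply_self, ha, zero_mul])

variable (K) in
/-- Evaluation at `(x, x)`. -/
def evalDiag (x : P) : IncidenceAlgebra K P →ₐ[K] K :=
  AlgHom.ofLinearMap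
    { toFun := fun f => f x x
      map_add' := fun _ _ => rfl
      map_smul' := fun _ _ => rfl }
    (by simp) (fun f g => mul_apply_self f g x)

omit [Fintype P] in
lemma evalDiag_apply (x : P) (f : IncidenceAlgebra K P) : evalDiag K x f = f x x := rfl

variable (K P) in
/-- The frame of an incidence algebra given by the diagonal idempotents. -/
def pointedFrame : PointedFrame K (IncidenceAlgebra K P) P where
  e := diagSingle K
  π := evalDiag K
  complete := completeOrthogonalIdempotents_diagSingle
  π_self x := by simp [evalDiag_apply, diagSingle_apply]
  π_ne x y h := by simp [evalDiag_apply, diagSingle_apply, h]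
  mem_jacobson := mem_jacobson_of_forall_apply_self_eq_zero

variable (K P) in
/-- The inclusion of the incidence algebra into the matrix algebra. -/
def toMatrixAlgHom : IncidenceAlgebra K P →ₐ[K] Matrix P P K :=
  AlgHom.ofLinearMap
    { toFun := fun f => Matrix.of f
      map_add' := fun _ _ => rfl
      map_smul' := fun _ _ => rfl }
    (by ext a b; simp only [Matrix.one_apply]; rfl)
    (fun f g => by ext a b; exact mul_apply_eq_sum f g a b)

end IncidenceAlgebra

/-- Matrices act on column vectors `K^P`. The basis vectors recover all entries, so the action is
faithful, and the idempotent at `x` cuts out the `x`-th coordinate line. -/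
theorem IsPosetIncidenceAlgebra.exists_isThinModule {K : Type u} {A : Type v} [Field K] [Ring A]
    [Algebra K A] (h : IsPosetIncidenceAlgebra K A) :
    ∃ (M : Type (max u w)) (_ : AddCommGroup M) (_ : Module K M) (_ : Module A M)
      (_ : IsScalarTower K A M), FiniteDimensional K M ∧ FaithfulSMul A M ∧ IsThinModule A M := by
  obtain ⟨P, _, _, _, _, ⟨φ⟩⟩ := h
  have : Fintype P := Fintype.ofFinite P
  let L : ULift.{w} (P → K) ≃ₗ[K] (P → K) := ULift.moduleEquiv
  let ρ : A →ₐ[K] Module.End K (ULift.{w} (P → K)) :=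
    (L.symm.conjAlgEquiv K).toAlgHom.comp ((Matrix.toLinAlgEquiv' (R := K) (n := P)).toAlgHom.comp
      ((IncidenceAlgebra.toMatrixAlgHom K P).comp φ.toAlgHom))
  let _ : Module A (ULift.{w} (P → K)) := Module.compHom _ ρ.toRingHom
  have hsmul : ∀ (a : A) (m : ULift.{w} (P → K)) (x : P),
      L (a • m) x = ∑ y, φ a x y * L m y := fun a m x => rfl
  have : IsScalarTower K A (ULift.{w} (P → K)) := ⟨fun k a m => by
    change ρ (k • a) m = k • ρ a m
    rw [map_smul, LinearMap.smul_apply]⟩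
  have : FiniteDimensional K (ULift.{w} (P → K)) := L.symm.finiteDimensional
  refine ⟨ULift.{w} (P → K), inferInstance, inferInstance, inferInstance, inferInstance,
    inferInstance, ⟨fun {a b} hab => ?_⟩, fun S _ _ hS => ?_⟩
  · apply φ.injective
    ext x y _
    have := congrFun (congrArg L (hab (L.symm (Pi.single y 1)))) x
    rw [hsmul, hsmul] at this
    simpa [Pi.single_apply] using this
  · let F := (IncidenceAlgebra.pointedFrame K P).map φ.symm
    obtain ⟨x, hx⟩ := F.exists_isOfType S
    rw [hx.jhMultiplicity_eq (K := K)]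
    refine finrank_le_one ⟨F.e x • L.symm (Pi.single x 1), ⟨_, rfl⟩⟩ ?_
    rintro ⟨_, m, rfl⟩
    refine ⟨L m x, Subtype.ext (L.injective ?_)⟩
    ext z
    change L (L m x • F.e x • L.symm (Pi.single x 1)) z = L (F.e x • m) z
    have he : φ (F.e x) = IncidenceAlgebra.diagSingle K x := φ.apply_symm_apply _
    rw [map_smul, Pi.smul_apply, hsmul, hsmul, he, Finset.sum_eq_single x, Finset.sum_eq_single x]
    · simp [mul_comm]
    · intro y _ hy
      simp [IncidenceAlgebra.diagSingle_apply, hy]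
    · simp
    · intro y _ hy
      simp [IncidenceAlgebra.diagSingle_apply, hy]
    · simp

/-! ### Modules with one-dimensional Peirce components -/

namespace PointedFrame

section Coordinates

variable {K A ι : Type*} [Field K] [Ring A] [Algebra K A] [Fintype ι] (F : PointedFrame K A ι)
  (M : Type*) [AddCommGroup M] [Module K M] [Module A M] [IsScalarTower K A M]

/-- A basis `v` of `M` with coordinate functions `c` such that `v i` spans `(e i) M`. -/
structure Coordinates where
  v : ι → M
  c : ι → M →ₗ[K] K
  ne_zero : ∀ i, v i ≠ 0
  e_smul_v : ∀ i, F.e i • v i = v i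
  e_smul : ∀ i x, F.e i • x = c i x • v i

variable {F M}

lemma finrank_smulRange_ne_zero [FiniteDimensional K M] [FaithfulSMul A M] (i : ι) :
    Module.finrank K (smulRange K (F.e i) M) ≠ 0 := by
  intro h
  have h0 : smulRange K (F.e i) M = ⊥ := Submodule.finrank_eq_zero.1 h
  have he : F.e i = 0 := FaithfulSMul.eq_of_smul_eq_smul (α := M) fun m => by
    have : F.e i • m ∈ smulRange K (F.e i) M := ⟨m, rfl⟩
    rw [h0, Submodule.mem_bot] at this
    rw [this, zero_smul]
  have := F.π_self i
  rw [he, map_zero] at this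
  exact zero_ne_one this

lemma nonempty_coordinates (h : ∀ i, Module.finrank K (smulRange K (F.e i) M) = 1) :
    Nonempty (F.Coordinates M) := by
  have key : ∀ i, ∃ (v : M) (c : M →ₗ[K] K), v ≠ 0 ∧ F.e i • v = v ∧
      ∀ x, F.e i • x = c x • v := fun i => by
    obtain ⟨⟨v, hv⟩, hv0, hspan⟩ := finrank_eq_one_iff'.1 (h i)
    have hv0' : v ≠ 0 := fun h => hv0 (Subtype.ext h)
    obtain ⟨f, hf⟩ : ∃ f : Module.Dual K M, f v ≠ 0 := by
      by_contra! h0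
      exact hv0' ((Module.forall_dual_apply_eq_zero_iff K v).1 h0)
    -- Any form `f` with `f v ≠ 0` measures multiples of `v`; the coordinate of `x` is `f (e i • x)
    -- / f v`.
    refine ⟨v, (f v)⁻¹ • f ∘ₗ (Algebra.lsmul K K M (F.e i)), hv0',
      (mem_smulRange_iff K (F.idem i) v).1 hv, fun x => ?_⟩
    obtain ⟨k, hk⟩ := hspan ⟨F.e i • x, ⟨x, rfl⟩⟩
    have hk' : k • v = F.e i • x := congrArg Subtype.val hk
    simp only [LinearMap.smul_apply, LinearMap.comp_apply, Algebra.lsmul_coe, ← hk', map_smul,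
      smul_eq_mul]
    congr 1
    field_simp
  choose v c h1 h2 h3 using key
  exact ⟨⟨v, c, h1, h2, h3⟩⟩

namespace Coordinates

variable (b : F.Coordinates M)

omit [IsScalarTower K A M] in
lemma sum_c_smul_v (x : M) : ∑ i, b.c i x • b.v i = x := by
  simp_rw [← b.e_smul]
  exact F.sum_e_smul x

omit [IsScalarTower K A M] in
lemma c_eq_of_e_smul {i : ι} {x : M} {k : K} (h : F.e i • x = k • b.v i) : b.c i x = k := by
  rw [b.e_smul] at h
  exact smul_left_injective K (b.ne_zero i) h

omit [IsScalarTower K A M] in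
lemma c_v_self (i : ι) : b.c i (b.v i) = 1 :=
  b.c_eq_of_e_smul (by rw [b.e_smul_v, one_smul])

omit [IsScalarTower K A M] in
lemma c_e_smul_self (i : ι) (x : M) : b.c i (F.e i • x) = b.c i x :=
  b.c_eq_of_e_smul (by rw [smul_smul, F.idem, b.e_smul])

omit [IsScalarTower K A M] in
lemma c_e_smul_ne {i j : ι} (h : i ≠ j) (x : M) : b.c i (F.e j • x) = 0 :=
  b.c_eq_of_e_smul (by rw [smul_smul, F.ortho h, zero_smul, zero_smul])

omit [IsScalarTower K A M] in
lemma c_v_ne {i j : ι} (h : i ≠ j) : b.c i (b.v j) = 0 := by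
  rw [← b.e_smul_v, b.c_e_smul_ne h]

/-- The matrix coefficients of the action of `A` on `M`. -/
def coeff (i j : ι) : A →ₗ[K] K :=
  b.c i ∘ₗ (LinearMap.toSpanSingleton A M (b.v j)).restrictScalars K

lemma coeff_apply (i j : ι) (a : A) : b.coeff i j a = b.c i (a • b.v j) := rfl

lemma smul_v (a : A) (j : ι) : a • b.v j = ∑ i, b.coeff i j a • b.v i :=
  (b.sum_c_smul_v _).symm

lemma coeff_mul (i j : ι) (x y : A) :
    b.coeff i j (x * y) = ∑ l, b.coeff i l x * b.coeff l j y := by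
  rw [coeff_apply, mul_smul, b.smul_v y, Finset.smul_sum, map_sum]
  refine Finset.sum_congr rfl fun l _ => ?_
  rw [smul_comm, map_smul, smul_eq_mul, mul_comm, coeff_apply b i l]

lemma coeff_one_self (i : ι) : b.coeff i i 1 = 1 := by
  rw [coeff_apply, one_smul, c_v_self]

lemma coeff_one_ne {i j : ι} (h : i ≠ j) : b.coeff i j 1 = 0 := by
  rw [coeff_apply, one_smul, b.c_v_ne h]

/-- Inserting `e j` keeps a single term of the matrix product, so nonzero coefficients multiply
without cancellation. This gives transitivity and antisymmetry of the order. -/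
lemma coeff_mul_e_mul (i j l : ι) (x y : A) :
    b.coeff i l (x * F.e j * y) = b.coeff i j x * b.coeff j l y := by
  rw [coeff_apply, mul_smul, mul_smul, b.e_smul, smul_comm, map_smul, smul_eq_mul, mul_comm]
  rfl

lemma coeff_e_mul_mul_e_self (i j : ι) (x : A) :
    b.coeff i j (F.e i * x * F.e j) = b.coeff i j x := by
  rw [coeff_apply, mul_smul, mul_smul, b.e_smul_v, b.c_e_smul_self, coeff_apply]

lemma coeff_e_mul_mul_e_ne {i j k l : ι} (x : A) (h : k ≠ i ∨ l ≠ j) :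
    b.coeff k l (F.e i * x * F.e j) = 0 := by
  rw [coeff_apply, mul_smul, mul_smul]
  rcases h with h | h
  · exact b.c_e_smul_ne h _
  · rw [← b.e_smul_v l, smul_smul (F.e j), F.ortho h.symm, zero_smul, smul_zero, smul_zero,
      map_zero]

lemma coeff_injective [FaithfulSMul A M] {x y : A} (h : ∀ i j, b.coeff i j x = b.coeff i j y) :
    x = y := by
  refine FaithfulSMul.eq_of_smul_eq_smul (α := M) fun m => ?_
  rw [← b.sum_c_smul_v m, Finset.smul_sum, Finset.smul_sum]
  refine Finset.sum_congr rfl fun j _ => ?_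
  rw [smul_comm, smul_comm y, b.smul_v, b.smul_v]
  simp_rw [h]

/-- The nilpotent element `e i * x * e i` acts on `v i` by this scalar, which is therefore zero. -/
lemma coeff_self_of_mem_jacobson [IsArtinianRing A] {x : A} (hx : x ∈ Ring.jacobson A) (i : ι) :
    b.coeff i i x = 0 := by
  obtain ⟨n, hn⟩ := IsSemiprimaryRing.isNilpotent (R := A)
  have hy : F.e i * x * F.e i ∈ Ring.jacobson A :=
    Ideal.mul_mem_right _ _ (Ideal.mul_mem_left _ _ hx)
  have h0 : (F.e i * x * F.e i) ^ n = 0 := by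
    have := Ideal.pow_mem_pow hy n
    rw [hn] at this
    exact this
  have h1 : (F.e i * x * F.e i) • b.v i = b.coeff i i x • b.v i := by
    rw [mul_smul, mul_smul, b.e_smul_v, b.e_smul, coeff_apply]
  have h2 : ∀ k : ℕ, (F.e i * x * F.e i) ^ k • b.v i = b.coeff i i x ^ k • b.v i := by
    intro k
    induction k with
    | zero => simp
    | succ k ih => rw [pow_succ, mul_smul, h1, smul_comm, ih, smul_smul, pow_succ']
  have h3 := h2 n
  rw [h0, zero_smul] at h3
  exact eq_zero_of_pow_eq_zero ((smul_eq_zero.1 h3.symm).resolve_right (b.ne_zero i))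

/-- The vertices are ordered by `i ≤ j` if and only if `(e i) A (e j) ≠ 0`. -/
abbrev partialOrder [IsArtinianRing A] : PartialOrder ι where
  le i j := ∃ a, b.coeff i j a ≠ 0
  le_refl i := ⟨1, by rw [coeff_one_self]; exact one_ne_zero⟩
  le_trans i j l := by
    rintro ⟨x, hx⟩ ⟨y, hy⟩
    exact ⟨x * F.e j * y, by rw [coeff_mul_e_mul]; exact mul_ne_zero hx hy⟩
  le_antisymm i j := by
    rintro ⟨x, hx⟩ ⟨y, hy⟩
    by_contra hij
    -- For `i ≠ j` all `π l` vanish on `e i * x * e j`. Its product with `e j * y` is thus in the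
    -- radical, but has the product of two nonzero coefficients on the diagonal.
    have hmem : F.e i * x * F.e j ∈ Ring.jacobson A := F.mem_jacobson _ fun l => by
      by_cases h : l = i
      · subst h; simp [F.π_ne l j hij]
      · simp [F.π_ne l i h]
    have h := b.coeff_self_of_mem_jacobson (x := F.e i * x * F.e j * F.e j * y)
      (Ideal.mul_mem_right _ _ (Ideal.mul_mem_right _ _ hmem)) i
    rw [coeff_mul_e_mul, coeff_e_mul_mul_e_self] at h
    exact mul_ne_zero hx hy h

lemma nonempty_algEquiv [FaithfulSMul A M] [PartialOrder ι] [LocallyFiniteOrder ι]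
    [DecidableEq ι] (hle : ∀ i j, i ≤ j ↔ ∃ a, b.coeff i j a ≠ 0) :
    Nonempty (A ≃ₐ[K] IncidenceAlgebra K ι) := by
  let f : A →ₐ[K] IncidenceAlgebra K ι := AlgHom.ofLinearMap
    { toFun := fun a => ⟨fun i j => b.coeff i j a, fun i j h => by
        by_contra h0
        exact h ((hle i j).2 ⟨a, h0⟩)⟩
      map_add' := fun x y => by
        ext i j _
        exact map_add (b.coeff i j) x y
      map_smul' := fun k x => by
        ext i j _
        exact map_smul (b.coeff i j) k x }
    (by
      ext i j _
      rw [IncidenceAlgebra.one_apply]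
      split_ifs with h
      · subst h
        exact b.coeff_one_self i
      · exact b.coeff_one_ne h)
    (fun x y => by
      ext i j _
      rw [IncidenceAlgebra.mul_apply_eq_sum]
      exact b.coeff_mul i j x y)
  have hf : ∀ a i j, f a i j = b.coeff i j a := fun _ _ _ => rfl
  refine ⟨AlgEquiv.ofBijective f ⟨fun x y hxy => b.coeff_injective fun i j => ?_, fun g => ?_⟩⟩
  · rw [← hf, ← hf, hxy]
  · have key : ∀ i j, ∃ a, b.coeff i j a = g i j := fun i j => by
      by_cases h : i ≤ j
      · obtain ⟨a, ha⟩ := (hle i j).1 h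
        refine ⟨(g i j * (b.coeff i j a)⁻¹) • a, ?_⟩
        rw [map_smul, smul_eq_mul, inv_mul_cancel_right₀ ha]
      · exact ⟨0, by rw [map_zero, IncidenceAlgebra.apply_eq_zero_of_not_le h]⟩
    choose a ha using key
    -- Each summand `e i * a i j * e j` is supported at the single position `(i, j)`, where it has
    -- the prescribed entry.
    refine ⟨∑ i, ∑ j, F.e i * a i j * F.e j, ?_⟩
    ext k l _
    rw [hf, map_sum, Finset.sum_eq_single k, map_sum, Finset.sum_eq_single l,
      coeff_e_mul_mul_e_self, ha]
    · exact fun j _ hj => b.coeff_e_mul_mul_e_ne _ (Or.inr hj.symm)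
    · simp
    · intro i _ hi
      rw [map_sum]
      exact Finset.sum_eq_zero fun j _ => b.coeff_e_mul_mul_e_ne _ (Or.inl hi.symm)
    · simp

include b in
-- A submodule containing a vector with nonzero `i`-th coordinate contains all of `(e i) M`. So
-- membership can be tested one coordinate at a time.
lemma isDistributiveModule : IsDistributiveModule A M := by
  intro X Y Z
  refine le_antisymm ?_ (le_inf (sup_le inf_le_left inf_le_left)
    (sup_le_sup inf_le_right inf_le_right))
  rintro x ⟨hX, hYZ⟩
  have key : ∀ (W : Submodule A M) (w : M) (i : ι), w ∈ W → b.c i w ≠ 0 →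
      F.e i • x ∈ W := fun W w i hw h => by
    have : F.e i • x = (b.c i x * (b.c i w)⁻¹) • F.e i • w := by
      rw [b.e_smul, b.e_smul i w, smul_smul, inv_mul_cancel_right₀ h]
    rw [this]
    exact W.smul_of_tower_mem _ (W.smul_mem _ hw)
  obtain ⟨y, hy, z, hz, rfl⟩ := Submodule.mem_sup.1 hYZ
  rw [← F.sum_e_smul (y + z)]
  refine Submodule.sum_mem _ fun i _ => ?_
  have hXi : F.e i • (y + z) ∈ X := X.smul_mem _ hX
  by_cases h1 : b.c i y = 0
  · by_cases h2 : b.c i z = 0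
    · rw [b.e_smul, map_add, h1, h2, add_zero, zero_smul]
      exact Submodule.zero_mem _
    · exact Submodule.mem_sup_right ⟨hXi, key Z z i hz h2⟩
  · exact Submodule.mem_sup_left ⟨hXi, key Y y i hy h1⟩

end Coordinates

/-- If `e i J e i = 0` then `(e i) M` is at most one-dimensional for distributive `M`. -/
lemma exists_span_of_isDistributiveModule (hM : IsDistributiveModule A M) {i : ι}
    (hi : ∀ x ∈ Ring.jacobson A, F.e i * x * F.e i = 0) :
    ∃ v : M, F.e i • v = v ∧ ∀ x, ∃ k : K, F.e i • x = k • v := by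
  -- Since `(e i) J (e i) = 0`, the corner `(e i) A (e i)` acts on `(e i) M` by scalars.
  have hact : ∀ (r : A) (x : M), F.e i • x = x → F.e i • r • x = F.π i r • x := fun r x hx => by
    have h := congrArg (· • x) (hi _ (F.mul_e_sub_mem r i))
    simp only [mul_smul, sub_smul, smul_sub, hx, zero_smul, algebraMap_smul] at h
    rwa [smul_comm (F.e i) (F.π i r), hx, sub_eq_zero] at h
  by_cases h0 : ∀ x : M, F.e i • x = 0
  · exact ⟨0, smul_zero _, fun x => ⟨0, by rw [h0, smul_zero]⟩⟩
  push Not at h0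
  obtain ⟨m, hm⟩ := h0
  set v := F.e i • m with hv
  have hev : F.e i • v = v := by rw [hv, smul_smul, F.idem]
  refine ⟨v, hev, fun x => ?_⟩
  set y := F.e i • x with hy
  have hey : F.e i • y = y := by rw [hy, smul_smul, F.idem]
  have hevy : F.e i • (v + y) = v + y := by rw [smul_add, hev, hey]
  -- Distributivity splits `v + y` into a part in `A v` and a part in `A y`, both in `A (v + y)`.
  -- Applying `e i` turns this into scalar relations between `v` and `y`.
  have hmem : v + y ∈ A ∙ (v + y) ⊓ ((A ∙ v) ⊔ (A ∙ y)) :=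
    ⟨Submodule.mem_span_singleton_self _,
      add_mem (Submodule.mem_sup_left (Submodule.mem_span_singleton_self _))
        (Submodule.mem_sup_right (Submodule.mem_span_singleton_self _))⟩
  rw [hM] at hmem
  obtain ⟨a, ⟨ha1, ha2⟩, c, ⟨hc1, hc2⟩, hac⟩ := Submodule.mem_sup.1 hmem
  obtain ⟨r, hr⟩ := Submodule.mem_span_singleton.1 ha1
  obtain ⟨s, hs⟩ := Submodule.mem_span_singleton.1 ha2
  obtain ⟨r', hr'⟩ := Submodule.mem_span_singleton.1 hc1
  obtain ⟨s', hs'⟩ := Submodule.mem_span_singleton.1 hc2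
  have e1 : F.π i r • (v + y) = F.π i s • v := by rw [← hact r _ hevy, ← hact s _ hev, hr, hs]
  have e2 : F.π i r' • (v + y) = F.π i s' • y := by
    rw [← hact r' _ hevy, ← hact s' _ hey, hr', hs']
  have e3 : F.π i r • (v + y) + F.π i r' • (v + y) = v + y := by
    rw [← hact r _ hevy, ← hact r' _ hevy, ← smul_add, hr, hr', hac, hevy]
  -- If `π i r ≠ 0`, then `e1` solves for `y`. Otherwise `e2` does if `π i r' ≠ 0`, its coefficient
  -- being nonzero because `v ≠ 0`. If both vanish, `e3` gives `y = -v`.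
  by_cases hr0 : F.π i r = 0
  · by_cases hr0' : F.π i r' = 0
    · rw [hr0, hr0', zero_smul, zero_add] at e3
      exact ⟨-1, by rw [neg_one_smul]; exact eq_neg_of_add_eq_zero_right e3.symm⟩
    · have hne : F.π i s' - F.π i r' ≠ 0 := by
        intro h
        rw [sub_eq_zero] at h
        rw [h, smul_add, add_eq_right] at e2
        exact hm ((smul_eq_zero.1 e2).resolve_left hr0')
      refine ⟨(F.π i s' - F.π i r')⁻¹ * F.π i r', ?_⟩
      rw [mul_smul, eq_inv_smul_iff₀ hne, sub_smul, ← e2, smul_add, add_sub_cancel_right]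
  · refine ⟨(F.π i r)⁻¹ * (F.π i s - F.π i r), ?_⟩
    rw [mul_smul, eq_inv_smul_iff₀ hr0, sub_smul, ← e1, smul_add, add_sub_cancel_left]

end Coordinates

/-! ### The implications of the theorem -/

section Main

variable {K : Type u} {A : Type v} {ι : Type} [Field K] [Ring A] [Algebra K A]
  [FiniteDimensional K A] [Fintype ι] {F : PointedFrame K A ι}
  {M : Type w} [AddCommGroup M] [Module K M] [Module A M] [IsScalarTower K A M]

omit [FiniteDimensional K A] in
lemma jhMultiplicity_simpleQuotient [FiniteDimensional K M] (i : ι) :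
    jhMultiplicity A M (F.simpleQuotient i) = Module.finrank K (smulRange K (F.e i) M) :=
  have := F.isSimpleModule_simpleQuotient i
  (F.isOfType_simpleQuotient i).jhMultiplicity_eq

omit [FiniteDimensional K A] in
lemma finrank_smulRange_of_isThinModule [FiniteDimensional K M] [FaithfulSMul A M]
    (h : IsThinModule A M) (i : ι) : Module.finrank K (smulRange K (F.e i) M) = 1 := by
  refine le_antisymm ?_ (Nat.one_le_iff_ne_zero.2 (finrank_smulRange_ne_zero i))
  rw [← jhMultiplicity_simpleQuotient]
  exact h _ (F.isSimpleModule_simpleQuotient i)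

omit [FiniteDimensional K A] in
include F in
lemma isOneRepresentation_of_isThinModule [FiniteDimensional K M] [FaithfulSMul A M]
    (h : IsThinModule A M) : IsOneRepresentation A M := by
  intro S _ _ hS
  obtain ⟨i, hi⟩ := F.exists_isOfType S
  rw [hi.jhMultiplicity_eq (K := K)]
  exact finrank_smulRange_of_isThinModule h i

lemma Coordinates.isPosetIncidenceAlgebra [FaithfulSMul A M] (b : F.Coordinates M) :
    IsPosetIncidenceAlgebra K A := by
  classical
  have : IsArtinianRing A := IsArtinianRing.of_finite K A
  let _ := b.partialOrder
  let _ : LocallyFiniteOrder ι := Fintype.toLocallyFiniteOrder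
  exact ⟨ι, inferInstance, inferInstance, inferInstance, inferInstance,
    b.nonempty_algEquiv fun i j => Iff.rfl⟩

/-- An arrow gives a radical element with a nonzero coefficient between the two types. Radical
elements have zero diagonal, so types strictly decrease along arrows and no path returns to its
start. -/
lemma Coordinates.isAcyclicAlgebra [FaithfulSMul A M] (b : F.Coordinates M) :
    IsAcyclicAlgebra A := by
  have : IsArtinianRing A := IsArtinianRing.of_finite K A
  let _ := b.partialOrder
  have htype : ∀ S : SimpleModules A, ∃ i, F.IsOfType i S.1 := fun S =>
    have := S.2
    F.exists_isOfType S.1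
  choose t ht using htype
  have harrow : ∀ S T, ExtArrow A S T → t T < t S := fun S T h => by
    obtain ⟨x, hx, hne⟩ := (ht S).exists_of_extArrow (ht T) h
    have hc : b.coeff (t T) (t S) x ≠ 0 := fun h0 => hne <| b.coeff_injective fun k l => by
      rw [map_zero]
      by_cases hkl : k = t T ∧ l = t S
      · obtain ⟨rfl, rfl⟩ := hkl
        rw [b.coeff_e_mul_mul_e_self, h0]
      · exact b.coeff_e_mul_mul_e_ne x (not_and_or.1 hkl)
    refine lt_of_le_of_ne ⟨x, hc⟩ fun h => hc ?_
    rw [h]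
    exact b.coeff_self_of_mem_jacobson hx _
  have hpath : ∀ S T, Relation.TransGen (ExtArrow A) S T → t T < t S := fun S T h => by
    induction h with
    | single h => exact harrow _ _ h
    | tail _ h ih => exact (harrow _ _ h).trans ih
  exact fun S h => lt_irrefl _ (hpath S S h)

include F in
-- Acyclicity excludes paths from a vertex to itself, so `(e i) J (e i) = 0` and each `(e i) M` is
-- spanned by one vector. Finite dimension of `M` follows from this and need not be assumed.
lemma isThinModule_of_isDistributiveModule (hA : IsAcyclicAlgebra A)
    (hM : IsDistributiveModule A M) : FiniteDimensional K M ∧ IsThinModule A M := by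
  have : IsArtinianRing A := IsArtinianRing.of_finite K A
  have key : ∀ i, ∃ v : M, F.e i • v = v ∧ ∀ x, ∃ k : K, F.e i • x = k • v := fun i =>
    exists_span_of_isDistributiveModule hM fun x hx =>
      e_mul_e_eq_zero_of_not_transGen (hA (F.simple i)) hx
  choose v hv hspan using key
  have hfin : FiniteDimensional K M := by
    refine Module.Finite.of_surjective (Fintype.linearCombination K v) fun x => ?_
    choose k hk using fun i => hspan i x
    exact ⟨k, by rw [Fintype.linearCombination_apply, ← F.sum_e_smul x]; simp_rw [hk]⟩
  refine ⟨hfin, fun S _ _ hS => ?_⟩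
  obtain ⟨i, hi⟩ := F.exists_isOfType S
  rw [hi.jhMultiplicity_eq (K := K)]
  refine finrank_le_one ⟨v i, ⟨v i, hv i⟩⟩ ?_
  rintro ⟨_, x, rfl⟩
  obtain ⟨k, hk⟩ := hspan i x
  exact ⟨k, Subtype.ext hk.symm⟩

end Main

end PointedFrame

theorem theorem4p10 (K : Type u) (A : Type v) [Field K] [Ring A] [Algebra K A]
    [FiniteDimensional K A] (hA : IsBasicPointed K A) :
    List.TFAE [
      -- `A` is an incidence algebra of a poset
      IsPosetIncidenceAlgebra K A,
      -- `A` is acyclic and has a faithful distributive representation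
      IsAcyclicAlgebra A ∧
        ∃ (M : Type (max u w)) (_ : AddCommGroup M) (_ : Module K M) (_ : Module A M)
          (_ : IsScalarTower K A M), FaithfulSMul A M ∧ IsDistributiveModule A M,
      -- `A` is acyclic and has a faithful finite-dimensional distributive representation
      IsAcyclicAlgebra A ∧
        ∃ (M : Type (max u w)) (_ : AddCommGroup M) (_ : Module K M) (_ : Module A M)
          (_ : IsScalarTower K A M),
          FiniteDimensional K M ∧ FaithfulSMul A M ∧ IsDistributiveModule A M,
      -- `A` has a faithful thin representation
      ∃ (M : Type (max u w)) (_ : AddCommGroup M) (_ : Module K M) (_ : Module A M)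
        (_ : IsScalarTower K A M),
        FiniteDimensional K M ∧ FaithfulSMul A M ∧ IsThinModule A M,
      -- `A` has a faithful 1-representation
      ∃ (M : Type (max u w)) (_ : AddCommGroup M) (_ : Module K M) (_ : Module A M)
        (_ : IsScalarTower K A M),
        FiniteDimensional K M ∧ FaithfulSMul A M ∧ IsOneRepresentation A M] := by
  obtain ⟨n, ⟨F⟩⟩ := hA.exists_pointedFrame
  tfae_have 1 → 4 := fun h => h.exists_isThinModule
  tfae_have 4 → 1 := fun ⟨M, _, _, _, _, _, _, hM⟩ => by
    obtain ⟨b⟩ := PointedFrame.nonempty_coordinates (F := F) (M := M)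
      (PointedFrame.finrank_smulRange_of_isThinModule hM)
    exact b.isPosetIncidenceAlgebra
  tfae_have 4 → 3 := fun ⟨M, _, _, _, _, hfin, hfaith, hM⟩ => by
    obtain ⟨b⟩ := PointedFrame.nonempty_coordinates (F := F) (M := M)
      (PointedFrame.finrank_smulRange_of_isThinModule hM)
    exact ⟨b.isAcyclicAlgebra, M, _, _, _, ‹_›, hfin, hfaith, b.isDistributiveModule⟩
  tfae_have 3 → 2 := fun ⟨hac, M, _, _, _, h, _, hfaith, hM⟩ =>
    ⟨hac, M, _, _, _, h, hfaith, hM⟩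
  tfae_have 2 → 4 := fun ⟨hac, M, _, _, _, h, hfaith, hM⟩ =>
    have hthin := F.isThinModule_of_isDistributiveModule hac hM
    ⟨M, _, _, _, h, hthin.1, hfaith, hthin.2⟩
  tfae_have 4 → 5 := fun ⟨M, _, _, _, h, hfin, hfaith, hM⟩ =>
    ⟨M, _, _, _, h, hfin, hfaith, F.isOneRepresentation_of_isThinModule hM⟩
  tfae_have 5 → 4 := fun ⟨M, _, _, _, h, hfin, hfaith, hM⟩ =>
    ⟨M, _, _, _, h, hfin, hfaith, fun S _ _ hS => (hM S hS).le⟩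
  tfae_finish
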